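/- Let $\mathcal{LC}$ be the set of all sequences $M=(M_j)_{j\in\mathbb{N}}$ of positive reals with $1=M_0\le M_1$, $M_j^2\le M_{j-1}M_{j+1}$ for all $j\ge 1$, and $\lim_{j\to\infty}(M_j)^{1/j}=+\infty$. For $M\in\mathcal{LC}$ put $\omega_M(0):=0$, $\omega_M(t):=\sup_{j\in\mathbb{N}}\log\big(t^j/M_j\big)$ for $t>0$, and $v_M(t):=\exp(-\omega_M(t))$, $t\ge 0$. A weight is a continuous non-increasing function $v:[0,\infty)\to(0,\infty)$ with $\lim_{t\to\infty}t^kv(t)=0$ for all $k\ge 0$; each $v_M$ is a weight with $v_M\le 1$. For $c>0$ put $v^c(t):=v(t)^c$. For weights $v,w$ write $v\preceq w$ if $w(t)=O(v(t))$ as $t\to\infty$; write $v\preceq^{\mathfrak c}w$ if $v\preceq w^c$ for some $c\ge 1$; and write $v\sim^{\mathfrak c}w$ if $v\preceq^{\mathfrak c}w$ and $w\preceq^{\mathfrak c}v$. For a weight $v$ let $H^\infty_v$ be the Banach space of all entire functions $f$ with $\|f\|_v:=\sup_{z\in\mathbb{C}}|f(z)|v(|z|)<\infty$. For $M\in\mathcal{LC}$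 let $$H^\infty_{\underline{\mathcal M}^{\mathfrak c}}:=\varinjlim_{c\in\mathbb{N}_{>0}}H^\infty_{v_M^{c}},\qquad H^\infty_{\overline{\mathcal M}^{\mathfrak c}}:=\varprojlim_{c\in\mathbb{N}_{>0}}H^\infty_{v_M^{1/c}},$$ i.e. the union of the spaces $H^\infty_{v_M^c}$ with the locally convex inductive limit topology (an (LB)-space), respectively the intersection of the spaces $H^\infty_{v_M^{1/c}}$ with the projective limit topology (a Fréchet space). **Theorem.** Let $M,N\in\mathcal{LC}$. The following are equivalent: (i) there are $c\in\mathbb{N}_{>0}$ and $A\ge 1$ such that $N_j\le A\,(M_{cj})^{1/c}$ for all $j\in\mathbb{N}$; (ii) $v_M\preceq^{\mathfrak c}v_N$; (iii) $H^\infty_{\underline{\mathcal M}^{\mathfrak c}}\subseteq H^\infty_{\underline{\mathcal N}^{\mathfrak c}}$ with continuous inclusion; (iv) $H^\infty_{\overline{\mathcal M}^{\mathfrak c}}\subseteq H^\infty_{\overline{\mathcal N}^{\mathfrak c}}$ with continuous inclusion. Consequently, the following are equivalent as well: $v_M\sim^{\mathfrak c}v_N$; $H^\infty_{\underline{\mathcal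 M}^{\mathfrak c}}=H^\infty_{\underline{\mathcal N}^{\mathfrak c}}$ as locally convex spaces (same elements, same topology); $H^\infty_{\overline{\mathcal M}^{\mathfrak c}}=H^\infty_{\overline{\mathcal N}^{\mathfrak c}}$ as locally convex spaces. -/

import Mathlib

open Filter Topology Asymptotics
open scoped NNReal

noncomputable section

/-! ### Weights -/

/-- A (radial) weight `v : [0, ∞) → (0, ∞)`: continuous, non-increasing, rapidly decreasing. -/
structure Weight where
  toFun : ℝ≥0 → ℝ
  pos : ∀ t, 0 < toFun t
  cont : Continuous toFun
  anti : Antitone toFun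
  decay : ∀ k : ℕ, Tendsto (fun t : ℝ≥0 => (t : ℝ) ^ k * toFun t) atTop (𝓝 0)

instance : CoeFun Weight (fun _ => ℝ≥0 → ℝ) := ⟨Weight.toFun⟩

/-- The weight `v ^ c : t ↦ v(t) ^ c`, for `c > 0`. -/
def Weight.rpow (v : Weight) (c : ℝ) (hc : 0 < c) : Weight where
  toFun := fun t => v t ^ c
  pos := fun t => Real.rpow_pos_of_pos (v.pos t) c
  cont := v.cont.rpow_const (fun t => Or.inl (v.pos t).ne')
  anti := fun _ t hst => Real.rpow_le_rpow (v.pos t).le (v.anti hst) hc.le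
  decay := by
    intro k
    obtain ⟨m, hm⟩ := exists_nat_ge ((k : ℝ) / c)
    have h1 : Tendsto (fun t : ℝ≥0 => ((t : ℝ) ^ m * v t) ^ c) atTop (𝓝 0) := by
      have h := (v.decay m).rpow_const (p := c) (Or.inr hc.le)
      rwa [Real.zero_rpow hc.ne'] at h
    refine squeeze_zero' (Eventually.of_forall fun t =>
      mul_nonneg (by positivity) (Real.rpow_pos_of_pos (v.pos t) c).le) ?_ h1
    filter_upwards [eventually_ge_atTop (1 : ℝ≥0)] with t ht
    have ht' : (1 : ℝ) ≤ t := by exact_mod_cast ht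
    rw [Real.mul_rpow (by positivity) (v.pos t).le]
    refine mul_le_mul_of_nonneg_right ?_ (Real.rpow_pos_of_pos (v.pos t) c).le
    rw [← Real.rpow_natCast, ← Real.rpow_natCast, ← Real.rpow_mul (by positivity)]
    refine Real.rpow_le_rpow_of_exponent_le ht' ?_
    rwa [div_le_iff₀ hc] at hm

/-- `v ≼ w`, i.e. `w(t) = O(v(t))` as `t → ∞`. -/
def Weight.Prec (v w : Weight) : Prop :=
  (fun t => w t) =O[atTop] (fun t => v t)

/-- `v ≼^𝔠 w`: there is `c ≥ 1` with `v ≼ w ^ c`. -/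
def Weight.PrecPow (v w : Weight) : Prop :=
  ∃ (c : ℝ) (hc : 1 ≤ c), v.Prec (w.rpow c (zero_lt_one.trans_le hc))

/-- `v ∼^𝔠 w`. -/
def Weight.EquivPow (v w : Weight) : Prop :=
  v.PrecPow w ∧ w.PrecPow v

/-! ### Weighted spaces of entire functions -/

/-- The entire functions, as a subspace of all functions. -/
def entireSubmodule : Submodule ℂ (ℂ → ℂ) where
  carrier := {f | Differentiable ℂ f}
  add_mem' := fun hf hg => Differentiable.add hf hg
  zero_mem' := differentiable_const 0
  smul_mem' := fun c _ hf => Differentiable.const_smul hf c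

/-- The vector space `H(ℂ)` of entire functions. It is a type of its own, so that it (and its
subspaces) do not inherit the topology of pointwise convergence. -/
def Entire : Type := entireSubmodule

instance : AddCommGroup Entire := inferInstanceAs (AddCommGroup entireSubmodule)
instance : Module ℂ Entire := inferInstanceAs (Module ℂ entireSubmodule)
instance : CoeFun Entire (fun _ => ℂ → ℂ) := ⟨fun f => f.1⟩

@[simp] theorem Entire.add_apply (f g : Entire) (z : ℂ) : (f + g) z = f z + g z := rfl
@[simp] theorem Entire.zero_apply (z : ℂ) : (0 : Entire) z = 0 := rfl
@[simp] theorem Entire.neg_apply (f : Entire) (z : ℂ) : (-f) z = -f z := rfl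
@[simp] theorem Entire.smul_apply (c : ℂ) (f : Entire) (z : ℂ) : (c • f) z = c * f z := rfl

theorem Entire.ext {f g : Entire} (h : ∀ z, f z = g z) : f = g :=
  Subtype.ext (funext h)

/-- `H^∞_v`: the entire `f` with `sup_z |f(z)| v(|z|) < ∞`. -/
def HInf (v : Weight) : Submodule ℂ Entire where
  carrier := {f | BddAbove (Set.range fun z : ℂ => ‖f z‖ * v ‖z‖₊)}
  add_mem' := by
    rintro f g ⟨A, hA⟩ ⟨B, hB⟩
    refine ⟨A + B, ?_⟩
    rintro _ ⟨z, rfl⟩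
    have h1 : ‖f z‖ * v ‖z‖₊ ≤ A := hA ⟨z, rfl⟩
    have h2 : ‖g z‖ * v ‖z‖₊ ≤ B := hB ⟨z, rfl⟩
    have h3 := mul_le_mul_of_nonneg_right (norm_add_le (f z) (g z)) (v.pos ‖z‖₊).le
    simp only [Entire.add_apply]
    linarith
  zero_mem' := ⟨0, by rintro _ ⟨z, rfl⟩; simp⟩
  smul_mem' := by
    rintro c f ⟨A, hA⟩
    refine ⟨‖c‖ * A, ?_⟩
    rintro _ ⟨z, rfl⟩
    have h1 : ‖f z‖ * v ‖z‖₊ ≤ A := hA ⟨z, rfl⟩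
    have h2 := mul_le_mul_of_nonneg_left h1 (norm_nonneg c)
    simp only [Entire.smul_apply, norm_mul]
    linarith

/-- The norm `‖f‖_v = sup_z |f(z)| v(|z|)` on `H^∞_v`. -/
def HInf.addGroupNorm (v : Weight) : AddGroupNorm (HInf v) where
  toFun := fun f => ⨆ z : ℂ, ‖f.1 z‖ * v ‖z‖₊
  map_zero' := by simp
  add_le' := by
    intro f g
    refine ciSup_le fun z => ?_
    have h1 := le_ciSup f.2 z
    have h2 := le_ciSup g.2 z
    have h3 := mul_le_mul_of_nonneg_right (norm_add_le (f.1 z) (g.1 z)) (v.pos ‖z‖₊).le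
    have h4 : (f + g).1 z = f.1 z + g.1 z := rfl
    rw [h4]
    linarith
  neg' := by
    intro f
    have h (z : ℂ) : (-f).1 z = -(f.1 z) := rfl
    simp only [h, norm_neg]
  eq_zero_of_map_eq_zero' := by
    intro f hf
    refine Subtype.ext (Entire.ext fun z => ?_)
    have h1 : ‖f.1 z‖ * v ‖z‖₊ ≤ 0 := hf ▸ le_ciSup f.2 z
    have h2 : ‖f.1 z‖ ≤ 0 := nonpos_of_mul_nonpos_left h1 (v.pos _)
    simpa using h2

instance (v : Weight) : NormedAddCommGroup (HInf v) :=
  (HInf.addGroupNorm v).toNormedAddCommGroup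

theorem HInf.norm_def (v : Weight) (f : HInf v) : ‖f‖ = ⨆ z : ℂ, ‖f.1 z‖ * v ‖z‖₊ := rfl

/-! ### Inductive and projective limits of weighted spaces -/

/-- The space underlying the inductive limit of the `H^∞_{v_n}`: the span of their union, which
for a non-increasing sequence of weights is the union itself (see `mem_indHInf`). -/
def IndHInf (V : ℕ+ → Weight) : Submodule ℂ Entire := ⨆ n, HInf (V n)

theorem HInf.mono {v w : Weight} (h : ∀ t, w t ≤ v t) : HInf v ≤ HInf w := by
  rintro f ⟨A, hA⟩
  refine ⟨A, ?_⟩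
  rintro _ ⟨z, rfl⟩
  exact (mul_le_mul_of_nonneg_left (h _) (norm_nonneg _)).trans (hA ⟨z, rfl⟩)

theorem mem_indHInf {V : ℕ+ → Weight} (hV : ∀ m n, m ≤ n → ∀ t, V n t ≤ V m t) (f : Entire) :
    f ∈ IndHInf V ↔ ∃ n, f ∈ HInf (V n) :=
  Submodule.mem_iSup_of_directed _
    (Monotone.directed_le fun m n hmn => HInf.mono (hV m n hmn))

/-- The inclusion of the `n`-th step into the inductive limit. -/
def IndHInf.incl (V : ℕ+ → Weight) (n : ℕ+) : HInf (V n) →ₗ[ℂ] IndHInf V :=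
  Submodule.inclusion (le_iSup (fun n => HInf (V n)) n)

/-- The (LB)-topology: the finest locally convex vector space topology for which the inclusions
of all the steps are continuous. -/
instance IndHInf.topology (V : ℕ+ → Weight) : TopologicalSpace (IndHInf V) :=
  sInf {t : TopologicalSpace (IndHInf V) |
    (∀ n, @Continuous _ _ _ t (IndHInf.incl V n)) ∧
    @IsTopologicalAddGroup (IndHInf V) t _ ∧
    @ContinuousSMul ℂ (IndHInf V) _ _ t ∧
    @LocallyConvexSpace ℝ (IndHInf V) _ _ _ _ t}

/-- The space underlying the projective limit of the `H^∞_{v_n}` for a non-decreasing sequence of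
weights: the intersection. -/
def ProjHInf (V : ℕ+ → Weight) : Submodule ℂ Entire := ⨅ n, HInf (V n)

/-- The inclusion of the projective limit into the `n`-th step. -/
def ProjHInf.incl (V : ℕ+ → Weight) (n : ℕ+) : ProjHInf V →ₗ[ℂ] HInf (V n) :=
  Submodule.inclusion (iInf_le (fun n => HInf (V n)) n)

/-- The Fréchet topology: the coarsest topology for which the inclusions into all the steps are
continuous. -/
instance ProjHInf.topology (V : ℕ+ → Weight) : TopologicalSpace (ProjHInf V) :=
  ⨅ n, TopologicalSpace.induced (ProjHInf.incl V n) inferInstance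

/-- `E ⊆ F` with continuous inclusion. -/
def ContIncl (E F : Submodule ℂ Entire) [TopologicalSpace E] [TopologicalSpace F] : Prop :=
  ∃ h : E ≤ F, Continuous (Submodule.inclusion h)

/-- `E = F` as topological vector spaces: same elements and same topology. -/
def EqTVS (E F : Submodule ℂ Entire) [TopologicalSpace E] [TopologicalSpace F] : Prop :=
  ∃ h : E = F, IsHomeomorph (LinearEquiv.ofEq E F h)

/-- The non-increasing exponential-type system `(v ^ c)_{c ∈ ℕ_{>0}}` (for `v ≤ 1`). -/
def Weight.expLower (v : Weight) (c : ℕ+) : Weight :=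
  v.rpow (c : ℝ) (Nat.cast_pos.2 c.pos)

/-- The non-decreasing exponential-type system `(v ^ (1/c))_{c ∈ ℕ_{>0}}` (for `v ≤ 1`). -/
def Weight.expUpper (v : Weight) (c : ℕ+) : Weight :=
  v.rpow (1 / (c : ℝ)) (one_div_pos.2 (Nat.cast_pos.2 c.pos))

/-! ### Weight sequences and associated weights -/

/-- A weight sequence: `M_j > 0`, `M_0 = 1` and `(M_j)^{1/j} → ∞`. -/
structure IsWeightSeq (M : ℕ → ℝ) : Prop where
  pos : ∀ j, 0 < M j
  zero : M 0 = 1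
  lim : Tendsto (fun j : ℕ => M j ^ (1 / (j : ℝ))) atTop atTop

/-- The class `𝓛𝓒` of normalized log-convex weight sequences. -/
structure IsLC (M : ℕ → ℝ) : Prop extends IsWeightSeq M where
  one_le : 1 ≤ M 1
  logConvex : ∀ j : ℕ, 1 ≤ j → M j ^ 2 ≤ M (j - 1) * M (j + 1)

/-- The associated weight function `ω_M(t) = sup_j log (t ^ j / M_j)` for `t > 0`, `ω_M(0) = 0`.
For a weight sequence the supremum is finite (see `IsWeightSeq.bddAbove`). -/
def assocWeight (M : ℕ → ℝ) (t : ℝ≥0) : ℝ :=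
  if t = 0 then 0 else ⨆ j : ℕ, Real.log ((t : ℝ) ^ j / M j)

namespace IsWeightSeq

variable {M : ℕ → ℝ}

theorem exists_pow_le (hM : IsWeightSeq M) (R : ℝ≥0) :
    ∃ J : ℕ, ∀ j, J ≤ j → ∀ t : ℝ≥0, t ≤ R → (t : ℝ) ^ j ≤ M j := by
  obtain ⟨J, hJ⟩ := eventually_atTop.1
    ((hM.lim.eventually_ge_atTop (R : ℝ)).and (eventually_ge_atTop 1))
  refine ⟨J, fun j hj t ht => ?_⟩
  obtain ⟨h1, h2⟩ := hJ j hj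
  have hj0 : (j : ℝ) ≠ 0 := by positivity
  calc (t : ℝ) ^ j ≤ (R : ℝ) ^ j := pow_le_pow_left₀ t.2 (by exact_mod_cast ht) j
    _ ≤ (M j ^ (1 / (j : ℝ))) ^ j := pow_le_pow_left₀ R.2 h1 j
    _ = M j := by
      rw [← Real.rpow_natCast, ← Real.rpow_mul (hM.pos j).le, one_div_mul_cancel hj0,
        Real.rpow_one]

theorem bddAbove (hM : IsWeightSeq M) (t : ℝ≥0) :
    BddAbove (Set.range fun j : ℕ => Real.log ((t : ℝ) ^ j / M j)) := by
  obtain ⟨J, hJ⟩ := hM.exists_pow_le t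
  have h0 : ∀ j, 0 ≤ (t : ℝ) ^ j / M j := fun j => div_nonneg (by positivity) (hM.pos j).le
  refine ⟨∑ i ∈ Finset.range J, (t : ℝ) ^ i / M i, ?_⟩
  rintro _ ⟨j, rfl⟩
  by_cases hj : j < J
  · exact (Real.log_le_self (h0 j)).trans
      (Finset.single_le_sum (f := fun i => (t : ℝ) ^ i / M i) (fun i _ => h0 i)
        (Finset.mem_range.2 hj))
  · exact (Real.log_nonpos (h0 j)
      ((div_le_one (hM.pos j)).2 (hJ j (not_lt.1 hj) t le_rfl))).trans
      (Finset.sum_nonneg fun i _ => h0 i)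

/-- `t ^ j / M_j ≤ exp (ω_M(t))`. -/
theorem le_exp (hM : IsWeightSeq M) (t : ℝ≥0) (j : ℕ) :
    (t : ℝ) ^ j / M j ≤ Real.exp (assocWeight M t) := by
  unfold assocWeight
  split_ifs with h
  · subst h
    rcases Nat.eq_zero_or_pos j with rfl | hj
    · simp [hM.zero]
    · simp [hj.ne']
  · have ht : (0 : ℝ) < t := by exact_mod_cast pos_iff_ne_zero.2 h
    have := le_ciSup (hM.bddAbove t) j
    rw [← Real.log_le_iff_le_exp (div_pos (pow_pos ht j) (hM.pos j))]
    exact this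

theorem exp_le_of_forall (hM : IsWeightSeq M) (t : ℝ≥0) {B : ℝ}
    (hB : ∀ j, (t : ℝ) ^ j / M j ≤ B) : Real.exp (assocWeight M t) ≤ B := by
  have hB1 : 1 ≤ B := by simpa [hM.zero] using hB 0
  rw [← Real.le_log_iff_exp_le (by linarith)]
  unfold assocWeight
  split_ifs with h
  · exact Real.log_nonneg hB1
  · have ht : (0 : ℝ) < t := by exact_mod_cast pos_iff_ne_zero.2 h
    exact ciSup_le fun j => Real.log_le_log (div_pos (pow_pos ht j) (hM.pos j)) (hB j)

theorem exp_mono (hM : IsWeightSeq M) : Monotone fun t => Real.exp (assocWeight M t) :=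
  fun s t hst => hM.exp_le_of_forall s fun j =>
    (div_le_div_of_nonneg_right
      (pow_le_pow_left₀ s.2 (by exact_mod_cast hst) j) (hM.pos j).le).trans (hM.le_exp t j)

theorem exp_eq (hM : IsWeightSeq M) (R : ℝ≥0) : ∃ J : ℕ, ∀ t : ℝ≥0, t ≤ R →
    Real.exp (assocWeight M t) =
      (Finset.range (J + 1)).sup' Finset.nonempty_range_add_one
        (fun j => (t : ℝ) ^ j / M j) := by
  obtain ⟨J, hJ⟩ := hM.exists_pow_le R
  refine ⟨J, fun t ht => le_antisymm (hM.exp_le_of_forall t fun j => ?_)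
    (Finset.sup'_le _ _ fun j _ => hM.le_exp t j)⟩
  by_cases hj : j < J + 1
  · exact Finset.le_sup' (fun j => (t : ℝ) ^ j / M j) (Finset.mem_range.2 hj)
  · refine ((div_le_one (hM.pos j)).2 (hJ j (by omega) t ht)).trans ?_
    have h1 : (1 : ℝ) = (t : ℝ) ^ 0 / M 0 := by simp [hM.zero]
    rw [h1]
    exact Finset.le_sup' (fun j => (t : ℝ) ^ j / M j) (Finset.mem_range.2 (Nat.succ_pos J))

theorem continuous_exp (hM : IsWeightSeq M) :
    Continuous fun t => Real.exp (assocWeight M t) := by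
  refine continuous_iff_continuousAt.2 fun t₀ => ?_
  obtain ⟨J, hJ⟩ := hM.exp_eq (t₀ + 1)
  have hc : Continuous fun t : ℝ≥0 =>
      (Finset.range (J + 1)).sup' Finset.nonempty_range_add_one
        (fun j => (t : ℝ) ^ j / M j) :=
    Continuous.finset_sup'_apply _ fun j _ => by fun_prop
  refine hc.continuousAt.congr ?_
  filter_upwards [Iic_mem_nhds (show t₀ < t₀ + 1 from lt_add_one t₀)] with t ht
  exact (hJ t ht).symm

/-- The weight `v_M(t) = exp (-ω_M(t))`. -/
def weight (hM : IsWeightSeq M) : Weight where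
  toFun := fun t => Real.exp (-assocWeight M t)
  pos := fun t => Real.exp_pos _
  cont := by
    simp only [Real.exp_neg]
    exact hM.continuous_exp.inv₀ fun t => (Real.exp_pos _).ne'
  anti := fun s t hst =>
    Real.exp_le_exp.2 (neg_le_neg (Real.exp_le_exp.1 (hM.exp_mono hst)))
  decay := by
    intro k
    have h1 : Tendsto (fun t : ℝ≥0 => M (k + 1) * (t : ℝ)⁻¹) atTop (𝓝 0) := by
      have h := (tendsto_inv_atTop_zero.comp
        (NNReal.tendsto_coe_atTop.2 (tendsto_id (x := atTop)))).const_mul (M (k + 1))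
      simpa using h
    refine squeeze_zero' (Eventually.of_forall fun t =>
      mul_nonneg (by positivity) (Real.exp_pos _).le) ?_ h1
    filter_upwards [eventually_ge_atTop (1 : ℝ≥0)] with t ht
    have ht' : (0 : ℝ) < t := zero_lt_one.trans_le (by exact_mod_cast ht)
    have h2 := hM.le_exp t (k + 1)
    rw [div_le_iff₀ (hM.pos _)] at h2
    rw [Real.exp_neg, ← div_eq_mul_inv, ← div_eq_mul_inv, div_le_div_iff₀ (Real.exp_pos _) ht',
      ← pow_succ]
    linarith

end IsWeightSeq

/-- The weight `v_M` for `M ∈ 𝓛𝓒`. -/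
def IsLC.weight {M : ℕ → ℝ} (hM : IsLC M) : Weight := hM.toIsWeightSeq.weight

theorem IsLC.weight_le_one {M : ℕ → ℝ} (hM : IsLC M) (t : ℝ≥0) : hM.weight t ≤ 1 := by
  have h := hM.toIsWeightSeq.le_exp t 0
  rw [pow_zero, hM.zero, div_one, Real.one_le_exp_iff] at h
  exact Real.exp_le_one_iff.2 (neg_nonpos.2 h)

theorem Weight.expLower_anti {v : Weight} (hv : ∀ t, v t ≤ 1) (m n : ℕ+) (hmn : m ≤ n) (t : ℝ≥0) :
    v.expLower n t ≤ v.expLower m t :=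
  Real.rpow_le_rpow_of_exponent_ge (v.pos t) (hv t) (by exact_mod_cast hmn)

theorem Weight.expUpper_mono {v : Weight} (hv : ∀ t, v t ≤ 1) (m n : ℕ+) (hmn : m ≤ n) (t : ℝ≥0) :
    v.expUpper m t ≤ v.expUpper n t :=
  Real.rpow_le_rpow_of_exponent_ge (v.pos t) (hv t)
    (one_div_le_one_div_of_le (Nat.cast_pos.2 m.pos) (by exact_mod_cast hmn))

end

/-!
All conditions are reduced to one global estimate `v_N ^ c ≤ K * v_M` with an integer `c ≥ 1`
(`Weight.precPow_iff`). It is related to the sequences through `sup_t t ^ j * v_M(t) = M_j`, where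
the supremum is attained because `M` is log-convex (`IsLC.exists_le_pow_mul_weight`); this gives
the comparison of sequences from that of weights. For the converse, indices are rounded down to
multiples of `c`, and the resulting factor `t ^ c` is absorbed into a power of `v_N`
(`IsLC.weight_le_of_seq_le`).

The estimate makes the inclusions between the steps of the inductive and projective systems
bounded, hence those between the limits continuous (`IndHInf.contIncl`, `ProjHInf.contIncl`).

Conversely, both inclusions are tested on monomials. For the projective limits, continuity
bounds `‖·‖` for `v_N` by a multiple of `‖·‖` for some `v_M ^ (1/c)`; on `z ^ j` these norms are
`N_j` and at most `(M_{cj}) ^ (1/c)` (`IsLC.seq_le_of_projHInf`). For the inductive limits, if the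
estimate failed for every `c`, there would be normalized monomials `z ^ j_k / M_{j_k}` whose norm
for `v_N ^ (k+1)` exceeds `4 ^ k`. Their sum with coefficients `2 ^ (-k)` lies in `H^∞_{v_M}`,
and since on the positive axis no cancellation occurs it lies in no `H^∞_{v_N ^ n}`
(`IsLC.weight_le_of_indHInf_le`). Continuity is not used in this last step.

Equality of the limits as topological vector spaces is continuous inclusion in both directions
(`eqTVS_iff`), so the second list follows by symmetry.
-/

/-! ### Powers of weights -/

/-- If `w ≤ 1`, the asymptotic condition `v ≼^𝔠 w` is equivalent to a global estimate with an
integer exponent. -/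
theorem Weight.precPow_iff {v w : Weight} (hw : ∀ t, w t ≤ 1) :
    v.PrecPow w ↔ ∃ c : ℕ, 1 ≤ c ∧ ∃ K : ℝ, 0 < K ∧ ∀ t, w t ^ c ≤ K * v t := by
  constructor
  · rintro ⟨c, hc, h⟩
    obtain ⟨n, hn⟩ := exists_nat_ge c
    obtain ⟨K, hK⟩ := h.bound
    obtain ⟨T, hT⟩ := eventually_atTop.1 hK
    have hle (t : ℝ≥0) : w t ^ n ≤ w t ^ c := by
      rw [← Real.rpow_natCast]
      exact Real.rpow_le_rpow_of_exponent_ge (w.pos t) (hw t) hn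
    have hn1 : 1 ≤ n := by exact_mod_cast hc.trans hn
    have hv := v.pos T
    refine ⟨n, hn1, max K (v T)⁻¹, lt_max_of_lt_right (inv_pos.2 hv), fun t => ?_⟩
    rcases le_total T t with ht | ht
    · have h1 := hT t ht
      have h2 : (w.rpow c (zero_lt_one.trans_le hc)) t = w t ^ c := rfl
      rw [h2, Real.norm_of_nonneg (Real.rpow_pos_of_pos (w.pos t) c).le,
        Real.norm_of_nonneg (v.pos t).le] at h1
      exact ((hle t).trans h1).trans
        (mul_le_mul_of_nonneg_right (le_max_left _ _) (v.pos t).le)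
    · calc w t ^ n ≤ 1 := pow_le_one₀ (w.pos t).le (hw t)
        _ = (v T)⁻¹ * v T := (inv_mul_cancel₀ hv.ne').symm
        _ ≤ max K (v T)⁻¹ * v t :=
          mul_le_mul (le_max_right _ _) (v.anti ht) hv.le
            ((inv_pos.2 hv).le.trans (le_max_right _ _))
  · rintro ⟨c, hc, K, -, h⟩
    refine ⟨c, by exact_mod_cast hc, IsBigO.of_bound K (Eventually.of_forall fun t => ?_)⟩
    have h2 : (w.rpow c (zero_lt_one.trans_le (by exact_mod_cast hc))) t = w t ^ (c : ℝ) := rfl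
    rw [h2, Real.norm_of_nonneg (Real.rpow_pos_of_pos (w.pos t) c).le,
      Real.norm_of_nonneg (v.pos t).le, Real.rpow_natCast]
    exact h t

theorem Weight.expLower_apply (v : Weight) (c : ℕ+) (t : ℝ≥0) :
    v.expLower c t = v t ^ (c : ℕ) :=
  Real.rpow_natCast _ _

theorem Weight.expUpper_apply (v : Weight) (c : ℕ+) (t : ℝ≥0) :
    v.expUpper c t = v t ^ (1 / ((c : ℕ) : ℝ)) :=
  rfl

/-! ### Continuous inclusions between weighted spaces and their limits -/

theorem HInf.le_norm {v : Weight} (f : HInf v) (z : ℂ) : ‖f.1 z‖ * v ‖z‖₊ ≤ ‖f‖ :=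
  le_ciSup f.2 z

theorem HInf.norm_le {v : Weight} (f : HInf v) {B : ℝ} (h : ∀ z, ‖f.1 z‖ * v ‖z‖₊ ≤ B) :
    ‖f‖ ≤ B :=
  ciSup_le h

theorem HInf.bound_of_le {v w : Weight} {K : ℝ} (h : ∀ t, w t ≤ K * v t) (f : HInf v) (z : ℂ) :
    ‖f.1 z‖ * w ‖z‖₊ ≤ max K 0 * ‖f‖ := by
  calc ‖f.1 z‖ * w ‖z‖₊ ≤ ‖f.1 z‖ * (max K 0 * v ‖z‖₊) :=
        mul_le_mul_of_nonneg_left ((h _).trans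
          (mul_le_mul_of_nonneg_right (le_max_left _ _) (v.pos _).le)) (norm_nonneg _)
    _ = max K 0 * (‖f.1 z‖ * v ‖z‖₊) := by ring
    _ ≤ max K 0 * ‖f‖ := mul_le_mul_of_nonneg_left (HInf.le_norm f z) (le_max_right _ _)

theorem HInf.contIncl {v w : Weight} {K : ℝ} (h : ∀ t, w t ≤ K * v t) :
    ContIncl (HInf v) (HInf w) := by
  have hle : HInf v ≤ HInf w := fun f hf =>
    ⟨max K 0 * ‖(⟨f, hf⟩ : HInf v)‖, by
      rintro _ ⟨z, rfl⟩
      exact HInf.bound_of_le h ⟨f, hf⟩ z⟩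
  exact ⟨hle, AddMonoidHomClass.continuous_of_bound (Submodule.inclusion hle) (max K 0)
    fun f => HInf.norm_le _ fun z => HInf.bound_of_le h f z⟩

/-- Each topology competing in the definition of the (LB)-topology on the target pulls back to one
competing on the source, so boundedness of the inclusions between the steps suffices. -/
theorem IndHInf.contIncl {V W : ℕ+ → Weight}
    (h : ∀ n, ∃ m, ∃ K : ℝ, ∀ t, W m t ≤ K * V n t) : ContIncl (IndHInf V) (IndHInf W) := by
  have hle : IndHInf V ≤ IndHInf W := iSup_le fun n => by
    obtain ⟨m, K, hK⟩ := h n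
    exact (HInf.contIncl hK).1.trans (le_iSup (fun n => HInf (W n)) m)
  refine ⟨hle, continuous_sInf_rng.2 fun τ ⟨h1, h2, h3, h4⟩ => ?_⟩
  rw [continuous_iff_le_induced]
  refine sInf_le ⟨fun n => ?_, ?_, ?_, ?_⟩
  · obtain ⟨m, K, hK⟩ := h n
    obtain ⟨hle', hc⟩ := HInf.contIncl hK
    rw [continuous_induced_rng]
    exact (h1 m).comp hc
  · exact topologicalAddGroup_induced (Submodule.inclusion hle)
  · exact continuousSMul_induced (Submodule.inclusion hle)
  · exact LocallyConvexSpace.induced ((Submodule.inclusion hle).restrictScalars ℝ)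

theorem ProjHInf.contIncl {V W : ℕ+ → Weight}
    (h : ∀ n, ∃ m, ∃ K : ℝ, ∀ t, W n t ≤ K * V m t) : ContIncl (ProjHInf V) (ProjHInf W) := by
  have hle : ProjHInf V ≤ ProjHInf W := le_iInf fun n => by
    obtain ⟨m, K, hK⟩ := h n
    exact (iInf_le (fun n => HInf (V n)) m).trans (HInf.contIncl hK).1
  refine ⟨hle, continuous_iInf_rng.2 fun n => continuous_induced_rng.2 ?_⟩
  obtain ⟨m, K, hK⟩ := h n
  obtain ⟨hle', hc⟩ := HInf.contIncl hK
  have hm : Continuous (ProjHInf.incl V m) := continuous_iInf_dom continuous_induced_dom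
  exact hc.comp hm

theorem eqTVS_iff (E F : Submodule ℂ Entire) [TopologicalSpace E] [TopologicalSpace F] :
    EqTVS E F ↔ ContIncl E F ∧ ContIncl F E := by
  constructor
  · rintro ⟨h, hh⟩
    refine ⟨⟨h.le, hh.continuous⟩, ⟨h.ge, ?_⟩⟩
    exact (hh.homeomorph).symm.continuous.congr fun x =>
      (hh.homeomorph).injective (by
        rw [Homeomorph.apply_symm_apply]; rfl)
  · rintro ⟨⟨h1, c1⟩, ⟨h2, c2⟩⟩
    refine ⟨le_antisymm h1 h2, ?_⟩
    exact Homeomorph.isHomeomorph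
      ⟨(LinearEquiv.ofEq E F (le_antisymm h1 h2)).toEquiv, c1, c2⟩

/-- For a non-decreasing system the norms of the steps are directed, so a single one of them
suffices to describe a neighbourhood of zero in the projective limit. -/
theorem ProjHInf.exists_ball_subset {V : ℕ+ → Weight} (hV : ∀ m n, m ≤ n → ∀ t, V m t ≤ V n t)
    {s : Set (ProjHInf V)} (hs : s ∈ 𝓝 0) :
    ∃ n, ∃ δ > 0, ∀ f, ‖ProjHInf.incl V n f‖ < δ → f ∈ s := by
  have hn : 𝓝 (0 : ProjHInf V) =
      ⨅ n, comap (fun f => ‖ProjHInf.incl V n f‖) (𝓝 (0 : ℝ)) := by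
    rw [ProjHInf.topology, nhds_iInf]
    refine iInf_congr fun n => ?_
    rw [nhds_induced, map_zero, ← comap_norm_nhds_zero, comap_comap]
    rfl
  have hdir : Directed (· ≥ ·) fun n =>
      comap (fun f => ‖ProjHInf.incl V n f‖) (𝓝 (0 : ℝ)) := by
    refine directed_of_isDirected_le fun m n hmn => ?_
    refine tendsto_iff_comap.1 (squeeze_zero (fun _ => norm_nonneg _) (fun f => ?_)
      tendsto_comap)
    exact HInf.norm_le _ fun z =>
      (mul_le_mul_of_nonneg_left (hV m n hmn _) (norm_nonneg _)).trans
        (HInf.le_norm (ProjHInf.incl V n f) z)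
  rw [hn, mem_iInf_of_directed hdir] at hs
  obtain ⟨n, t, ht, hts⟩ := hs
  obtain ⟨δ, hδ, hb⟩ := Metric.mem_nhds_iff.1 ht
  exact ⟨n, δ, hδ, fun f hf => hts (hb (by simpa using hf))⟩

/-! ### Log-convex sequences and their associated weights -/

theorem IsWeightSeq.pow_mul_weight_le {M : ℕ → ℝ} (hM : IsWeightSeq M) (t : ℝ≥0) (j : ℕ) :
    (t : ℝ) ^ j * hM.weight t ≤ M j := by
  have h := hM.le_exp t j
  have h1 : hM.weight t = (Real.exp (assocWeight M t))⁻¹ := Real.exp_neg _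
  rw [h1, ← div_eq_mul_inv, div_le_iff₀ (Real.exp_pos _)]
  rw [div_le_iff₀ (hM.pos j)] at h
  linarith

theorem IsWeightSeq.le_weight {M : ℕ → ℝ} (hM : IsWeightSeq M) (t : ℝ≥0) {B : ℝ} (hB : 0 < B)
    (h : ∀ j, (t : ℝ) ^ j * B ≤ M j) : B ≤ hM.weight t := by
  have h1 : hM.weight t = (Real.exp (assocWeight M t))⁻¹ := Real.exp_neg _
  rw [h1, le_inv_comm₀ hB (Real.exp_pos _)]
  refine hM.exp_le_of_forall t fun j => ?_
  rw [div_le_iff₀ (hM.pos j), ← div_eq_inv_mul, le_div_iff₀ hB]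
  exact h j

namespace IsLC

variable {M : ℕ → ℝ}

theorem pow_mul_weight_le (hM : IsLC M) (t : ℝ≥0) (j : ℕ) : (t : ℝ) ^ j * hM.weight t ≤ M j :=
  hM.toIsWeightSeq.pow_mul_weight_le t j

theorem ratio_mono (hM : IsLC M) : Monotone fun j => M (j + 1) / M j := by
  refine monotone_nat_of_le_succ fun j => ?_
  rw [div_le_div_iff₀ (hM.pos _) (hM.pos _)]
  have := hM.logConvex (j + 1) (by omega)
  simp only [Nat.add_sub_cancel] at this
  nlinarith

theorem mono (hM : IsLC M) : Monotone M := by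
  refine monotone_nat_of_le_succ fun j => ?_
  have h := hM.ratio_mono (Nat.zero_le j)
  simp only [zero_add, hM.zero, div_one] at h
  exact (one_le_div (hM.pos j)).1 (hM.one_le.trans h)

/-- The supremum of `t ^ j * v_M(t)` over `t` is `M_j`, attained at `t = M_{j+1} / M_j`. -/
theorem exists_le_pow_mul_weight (hM : IsLC M) (j : ℕ) :
    ∃ t : ℝ≥0, M j ≤ (t : ℝ) ^ j * hM.weight t := by
  have ht : 0 < M (j + 1) / M j := div_pos (hM.pos _) (hM.pos _)
  set r := M (j + 1) / M j with hr
  have hup (k : ℕ) : M j * r ^ k ≤ M (j + k) := by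
    induction k with
    | zero => simp
    | succ k ih =>
      have h := hM.ratio_mono (Nat.le_add_right j k)
      simp only [← hr] at h
      rw [le_div_iff₀ (hM.pos _)] at h
      calc M j * r ^ (k + 1) = r * (M j * r ^ k) := by ring
        _ ≤ r * M (j + k) := mul_le_mul_of_nonneg_left ih ht.le
        _ ≤ M (j + (k + 1)) := h
  have hdown (k i : ℕ) (hki : i + k = j) : M j ≤ M i * r ^ k := by
    induction k generalizing i with
    | zero => subst hki; simp
    | succ k ih =>
      have h := hM.ratio_mono (show i ≤ j by omega)
      simp only [← hr] at h
      rw [div_le_iff₀ (hM.pos _)] at h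
      calc M j ≤ M (i + 1) * r ^ k := ih (i + 1) (by omega)
        _ ≤ r * M i * r ^ k := mul_le_mul_of_nonneg_right h (by positivity)
        _ = M i * r ^ (k + 1) := by ring
  obtain ⟨t, htr⟩ : ∃ t : ℝ≥0, (t : ℝ) = r := ⟨r.toNNReal, Real.coe_toNNReal r ht.le⟩
  have hp : 0 < r ^ j := pow_pos ht j
  refine ⟨t, ?_⟩
  rw [htr, ← div_le_iff₀' hp]
  refine hM.toIsWeightSeq.le_weight _ (div_pos (hM.pos j) hp) fun k => ?_
  rw [htr, ← mul_div_assoc, div_le_iff₀ hp]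
  rcases le_total j k with h | h
  · obtain ⟨k, rfl⟩ := Nat.exists_eq_add_of_le h
    calc r ^ (j + k) * M j = M j * r ^ k * r ^ j := by ring
      _ ≤ M (j + k) * r ^ j := mul_le_mul_of_nonneg_right (hup k) hp.le
  · obtain ⟨i, hi⟩ := Nat.exists_eq_add_of_le h
    calc r ^ k * M j ≤ r ^ k * (M k * r ^ i) :=
          mul_le_mul_of_nonneg_left (hdown i k hi.symm) (by positivity)
      _ = M k * r ^ j := by rw [hi]; ring

variable {N : ℕ → ℝ}

/-- The comparison of the sequences gives the comparison of the weights: passing from the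
multiples of `c` to all indices costs a factor `t ^ c ≤ (N_1 / v_N(t)) ^ c`, which is absorbed by
doubling the exponent. -/
theorem weight_le_of_seq_le (hM : IsLC M) (hN : IsLC N) {c : ℕ} (hc : 1 ≤ c) {A : ℝ} (hA : 1 ≤ A)
    (h : ∀ j, N j ≤ A * M (c * j) ^ (1 / (c : ℝ))) :
    ∃ K : ℝ, 0 < K ∧ ∀ t, hN.weight t ^ (2 * c) ≤ K * hM.weight t := by
  have hN1 : 1 ≤ N 1 := hN.one_le
  have hc0 : (c : ℝ) ≠ 0 := by positivity
  refine ⟨A ^ c * N 1 ^ c, by positivity, fun t => ?_⟩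
  have hv := hN.weight.pos t
  have hv1 := hN.weight_le_one t
  rw [← div_le_iff₀' (by positivity)]
  refine hM.toIsWeightSeq.le_weight t (by positivity) fun k => ?_
  rw [← mul_div_assoc, div_le_iff₀ (by positivity)]
  have hmul (j : ℕ) : ((t : ℝ) ^ j * hN.weight t) ^ c ≤ A ^ c * M (c * j) := by
    have h1 := pow_le_pow_left₀ (by positivity) ((hN.pow_mul_weight_le t j).trans (h j)) c
    rwa [mul_pow A, ← Real.rpow_natCast (M (c * j) ^ _), ← Real.rpow_mul (hM.pos _).le,
      one_div_mul_cancel hc0, Real.rpow_one] at h1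
  have ht : ((t : ℝ) * hN.weight t) ^ c ≤ N 1 ^ c :=
    pow_le_pow_left₀ (by positivity) (by simpa using hN.pow_mul_weight_le t 1) c
  have hMk := hM.pos k
  rcases le_total (t : ℝ) 1 with ht1 | ht1
  · have hMk1 : 1 ≤ M k := hM.zero ▸ hM.mono (Nat.zero_le k)
    calc (t : ℝ) ^ k * hN.weight t ^ (2 * c) ≤ 1 * 1 :=
          mul_le_mul (pow_le_one₀ t.2 ht1) (pow_le_one₀ hv.le hv1) (by positivity) zero_le_one
      _ ≤ M k * (A ^ c * N 1 ^ c) :=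
          mul_le_mul hMk1 (one_le_mul_of_one_le_of_one_le (one_le_pow₀ hA) (one_le_pow₀ hN1))
            zero_le_one hMk.le
  · have hk : c * (k / c) ≤ k := Nat.mul_div_le k c
    have hk' : k ≤ c * (k / c) + c := by
      have := Nat.div_add_mod k c
      have := Nat.mod_lt k (show 0 < c by omega)
      omega
    calc (t : ℝ) ^ k * hN.weight t ^ (2 * c)
        ≤ (t : ℝ) ^ (c * (k / c) + c) * hN.weight t ^ (2 * c) :=
          mul_le_mul_of_nonneg_right (pow_le_pow_right₀ ht1 hk') (by positivity)
      _ = ((t : ℝ) ^ (k / c) * hN.weight t) ^ c * ((t : ℝ) * hN.weight t) ^ c := by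
          rw [mul_pow, mul_pow, ← pow_mul, mul_comm (k / c) c, pow_add]; ring
      _ ≤ A ^ c * M (c * (k / c)) * N 1 ^ c :=
          mul_le_mul (hmul _) ht (by positivity) (by have := hM.pos (c * (k / c)); positivity)
      _ ≤ A ^ c * M k * N 1 ^ c := by
          have := hM.mono hk
          gcongr
      _ = M k * (A ^ c * N 1 ^ c) := by ring

theorem seq_le_of_weight_le (hM : IsLC M) (hN : IsLC N) {c : ℕ} (hc : 1 ≤ c) {K : ℝ}
    (h : ∀ t, hN.weight t ^ c ≤ K * hM.weight t) (j : ℕ) :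
    N j ≤ max K 1 * M (c * j) ^ (1 / (c : ℝ)) := by
  obtain ⟨t, ht⟩ := hN.exists_le_pow_mul_weight j
  have hc0 : (c : ℝ) ≠ 0 := by positivity
  have hK : (1 : ℝ) ≤ max K 1 := le_max_right _ _
  have hMp := hM.pos (c * j)
  refine le_of_pow_le_pow_left₀ (n := c) (by omega) (by positivity) ?_
  rw [mul_pow, ← Real.rpow_natCast (M (c * j) ^ _), ← Real.rpow_mul hMp.le,
    one_div_mul_cancel hc0, Real.rpow_one]
  calc N j ^ c ≤ ((t : ℝ) ^ j * hN.weight t) ^ c := pow_le_pow_left₀ (hN.pos j).le ht c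
    _ = (t : ℝ) ^ (c * j) * hN.weight t ^ c := by rw [mul_pow, ← pow_mul, mul_comm j c]
    _ ≤ (t : ℝ) ^ (c * j) * (K * hM.weight t) :=
        mul_le_mul_of_nonneg_left (h t) (by positivity)
    _ ≤ (t : ℝ) ^ (c * j) * (max K 1 * hM.weight t) := by
        have := hM.weight.pos t
        gcongr
        exact le_max_left _ _
    _ = max K 1 * ((t : ℝ) ^ (c * j) * hM.weight t) := by ring
    _ ≤ max K 1 * M (c * j) :=
        mul_le_mul_of_nonneg_left (hM.pow_mul_weight_le t _) (by positivity)
    _ ≤ max K 1 ^ c * M (c * j) :=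
        mul_le_mul_of_nonneg_right (le_self_pow₀ hK (by omega)) hMp.le

/-! ### Entire functions testing the inclusions -/

/-- For any indices `J k`, the sum of the `2 ^ (-k) * z ^ J k / M_{J k}` is an entire function in
`H^∞_{v_M}`; having nonnegative coefficients, it dominates each of its terms on the positive axis. -/
theorem exists_entire_of_indices (hM : IsLC M) (J : ℕ → ℕ) :
    ∃ f : Entire, f ∈ HInf (hM.weight.expLower 1) ∧
      ∀ (k : ℕ) (t : ℝ≥0), (1 / 2 : ℝ) ^ k * ((t : ℝ) ^ J k / M (J k)) ≤ ‖f ((t : ℝ) : ℂ)‖ := by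
  let a : ℕ → ℝ := fun k => (1 / 2 : ℝ) ^ k / M (J k)
  have ha (k : ℕ) : 0 ≤ a k := div_nonneg (by positivity) (hM.pos _).le
  have hterm (k : ℕ) (z : ℂ) (t : ℝ≥0) (hz : ‖z‖ ≤ t) :
      ‖(a k : ℂ) * z ^ J k‖ ≤ (1 / 2 : ℝ) ^ k * (hM.weight t)⁻¹ := by
    have hv := hM.weight.pos t
    have hMp := hM.pos (J k)
    rw [norm_mul, norm_pow, Complex.norm_real, Real.norm_of_nonneg (ha k)]
    calc a k * ‖z‖ ^ J k ≤ a k * (t : ℝ) ^ J k := by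
          have := ha k
          gcongr
      _ = (1 / 2 : ℝ) ^ k * ((t : ℝ) ^ J k / M (J k)) := by simp only [a]; ring
      _ ≤ (1 / 2 : ℝ) ^ k * (hM.weight t)⁻¹ := by
          refine mul_le_mul_of_nonneg_left ?_ (by positivity)
          rw [div_le_iff₀ hMp, ← div_eq_inv_mul, le_div_iff₀ hv]
          exact hM.pow_mul_weight_le t _
  have hsum (t : ℝ≥0) : Summable fun k : ℕ => (1 / 2 : ℝ) ^ k * (hM.weight t)⁻¹ :=
    summable_geometric_two.mul_right _
  have hdiff : Differentiable ℂ fun z : ℂ => ∑' k, (a k : ℂ) * z ^ J k := by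
    intro z₀
    have hd : DifferentiableOn ℂ (fun z : ℂ => ∑' k, (a k : ℂ) * z ^ J k)
        (Metric.ball 0 (‖z₀‖ + 1)) :=
      Complex.differentiableOn_tsum_of_summable_norm (hsum (‖z₀‖₊ + 1))
        (fun k => by fun_prop) Metric.isOpen_ball
        (fun k z hz => hterm k z _ (by simpa using (mem_ball_zero_iff.1 hz).le))
    exact hd.differentiableAt (Metric.isOpen_ball.mem_nhds (by simp))
  refine ⟨⟨fun z => ∑' k, (a k : ℂ) * z ^ J k, hdiff⟩, ⟨2, ?_⟩, fun k t => ?_⟩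
  · rintro _ ⟨z, rfl⟩
    have hv := hM.weight.pos ‖z‖₊
    have h1 : ‖∑' k, (a k : ℂ) * z ^ J k‖ ≤ 2 * (hM.weight ‖z‖₊)⁻¹ := by
      refine tsum_of_norm_bounded ?_ fun k => hterm k z ‖z‖₊ le_rfl
      exact hasSum_geometric_two.mul_right _
    change ‖∑' k, (a k : ℂ) * z ^ J k‖ * hM.weight.expLower 1 ‖z‖₊ ≤ 2
    rw [Weight.expLower_apply, PNat.one_coe, pow_one, ← le_div_iff₀ hv]
    exact h1
  · have hs : Summable fun k => a k * (t : ℝ) ^ J k := by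
      refine Summable.of_nonneg_of_le (fun k => mul_nonneg (ha k) (by positivity))
        (fun k => ?_) (hsum t)
      have h := hterm k ((t : ℝ) : ℂ) t (by simp)
      rw [norm_mul, norm_pow, Complex.norm_real, Complex.norm_real,
        Real.norm_of_nonneg (ha k), Real.norm_of_nonneg t.coe_nonneg] at h
      exact h
    have h2 : ∑' k, (a k : ℂ) * ((t : ℝ) : ℂ) ^ J k = ((∑' k, a k * (t : ℝ) ^ J k : ℝ) : ℂ) := by
      push_cast
      rfl
    change _ ≤ ‖∑' k, (a k : ℂ) * ((t : ℝ) : ℂ) ^ J k‖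
    rw [h2, Complex.norm_real]
    calc (1 / 2 : ℝ) ^ k * ((t : ℝ) ^ J k / M (J k)) = a k * (t : ℝ) ^ J k := by
          simp only [a]; ring
      _ ≤ ∑' k, a k * (t : ℝ) ^ J k :=
          hs.le_tsum k fun i _ => mul_nonneg (ha i) (by positivity)
      _ ≤ _ := Real.le_norm_self _

/-- The set-theoretic inclusion of the inductive limits alone forces the comparison of the
weights, by a gliding hump argument. -/
theorem weight_le_of_indHInf_le (hM : IsLC M) (hN : IsLC N)
    (h : IndHInf hM.weight.expLower ≤ IndHInf hN.weight.expLower) :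
    ∃ c : ℕ, 1 ≤ c ∧ ∃ K : ℝ, 0 < K ∧ ∀ t, hN.weight t ^ c ≤ K * hM.weight t := by
  by_contra! hcon
  -- Otherwise, for each exponent `k` some normalized monomial has norm above `4 ^ k` for
  -- the weight `v_N ^ (k + 1)`.
  have hbad (k : ℕ) : ∃ (j : ℕ) (t : ℝ≥0),
      (4 : ℝ) ^ k * M j < (t : ℝ) ^ j * hN.weight t ^ (k + 1) := by
    by_contra! hk
    obtain ⟨t, ht⟩ := hcon (k + 1) (by omega) (4 ^ k) (by positivity)
    refine ht.not_ge ?_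
    have hv := hN.weight.pos t
    rw [← div_le_iff₀' (by positivity)]
    refine hM.toIsWeightSeq.le_weight t (by positivity) fun j => ?_
    rw [← mul_div_assoc, div_le_iff₀ (by positivity), mul_comm (M j)]
    exact hk j t
  choose J T hJT using hbad
  obtain ⟨f, hf, hfJ⟩ := hM.exists_entire_of_indices J
  have hf' : f ∈ IndHInf hN.weight.expLower :=
    h ((le_iSup (fun n => HInf (hM.weight.expLower n)) 1) hf)
  rw [mem_indHInf (Weight.expLower_anti hN.weight_le_one)] at hf'
  obtain ⟨n, C, hC⟩ := hf'
  obtain ⟨k, hk⟩ := pow_unbounded_of_one_lt C (one_lt_two : (1 : ℝ) < 2)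
  -- A hump beyond both the exponent and the constant of the estimate for `f`.
  set m := max k n with hm
  have h1 : ‖f ((T m : ℝ) : ℂ)‖ * hN.weight (T m) ^ (n : ℕ) ≤ C := by
    have := hC ⟨((T m : ℝ) : ℂ), rfl⟩
    simpa [Weight.expLower_apply] using this
  have hv := hN.weight.pos (T m)
  have hMp := hM.pos (J m)
  have h2 : hN.weight (T m) ^ (m + 1) ≤ hN.weight (T m) ^ (n : ℕ) :=
    pow_le_pow_of_le_one hv.le (hN.weight_le_one _) (by omega)
  have h3 : (4 : ℝ) ^ m < (T m : ℝ) ^ J m / M (J m) * hN.weight (T m) ^ (m + 1) := by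
    rw [div_mul_eq_mul_div, lt_div_iff₀ hMp]
    exact hJT m
  have h4 : (2 : ℝ) ^ m = (1 / 2 : ℝ) ^ m * 4 ^ m := by
    rw [← mul_pow]; norm_num
  have h5 : (2 : ℝ) ^ m < C := by
    calc (2 : ℝ) ^ m = (1 / 2 : ℝ) ^ m * 4 ^ m := h4
      _ < (1 / 2 : ℝ) ^ m * ((T m : ℝ) ^ J m / M (J m) * hN.weight (T m) ^ (m + 1)) :=
          mul_lt_mul_of_pos_left h3 (by positivity)
      _ = (1 / 2 : ℝ) ^ m * ((T m : ℝ) ^ J m / M (J m)) * hN.weight (T m) ^ (m + 1) := by ring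
      _ ≤ ‖f ((T m : ℝ) : ℂ)‖ * hN.weight (T m) ^ (n : ℕ) :=
          mul_le_mul (hfJ m (T m)) h2 (by positivity) (norm_nonneg _)
      _ ≤ C := h1
  exact absurd (hk.trans_le (pow_le_pow_right₀ one_le_two (le_max_left k n))) h5.not_gt

/-- The monomials satisfy `‖z ^ j‖ ≤ (M_{cj})^{1/c}` for the weight `v_M ^ (1/c)`. -/
theorem pow_mul_expUpper_le (hM : IsLC M) (c : ℕ+) (j : ℕ) (t : ℝ≥0) :
    (t : ℝ) ^ j * hM.weight.expUpper c t ≤ M (c * j) ^ (1 / ((c : ℕ) : ℝ)) := by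
  have hc : ((c : ℕ) : ℝ) ≠ 0 := by positivity
  have hv := hM.weight.pos t
  have h := Real.rpow_le_rpow (by positivity) (hM.pow_mul_weight_le t (c * j))
    (show 0 ≤ 1 / ((c : ℕ) : ℝ) by positivity)
  rwa [Real.mul_rpow (by positivity) hv.le, ← Real.rpow_natCast, ← Real.rpow_mul t.coe_nonneg,
    Nat.cast_mul, mul_one_div, mul_div_cancel_left₀ _ hc, Real.rpow_natCast] at h

/-- Continuity of the inclusion of the projective limits bounds one norm by another one; tested
on the monomials, this is the comparison of the sequences. -/
theorem seq_le_of_projHInf (hM : IsLC M) (hN : IsLC N)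
    (h : ContIncl (ProjHInf hM.weight.expUpper) (ProjHInf hN.weight.expUpper)) :
    ∃ c : ℕ, 1 ≤ c ∧ ∃ A : ℝ, 1 ≤ A ∧ ∀ j : ℕ, N j ≤ A * M (c * j) ^ (1 / (c : ℝ)) := by
  obtain ⟨hle, hcont⟩ := h
  have hincl : Continuous (ProjHInf.incl hN.weight.expUpper 1) :=
    continuous_iInf_dom continuous_induced_dom
  have hs : {f : ProjHInf hM.weight.expUpper |
      ‖ProjHInf.incl hN.weight.expUpper 1 (Submodule.inclusion hle f)‖ < 1} ∈ 𝓝 0 :=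
    (isOpen_lt (hincl.comp hcont).norm continuous_const).mem_nhds (by simp)
  obtain ⟨c, δ, hδ, hball⟩ :=
    ProjHInf.exists_ball_subset (Weight.expUpper_mono hM.weight_le_one) hs
  refine ⟨c, c.pos, max (2 / δ) 1, le_max_right _ _, fun j => ?_⟩
  have hB : 0 < M (c * j) ^ (1 / ((c : ℕ) : ℝ)) := Real.rpow_pos_of_pos (hM.pos _) _
  set B := M (c * j) ^ (1 / ((c : ℕ) : ℝ)) with hBdef
  -- The monomial `z ^ j`, scaled into the ball of radius `δ` of the step `c`.
  have ha : 0 < δ / 2 / B := by positivity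
  set a : ℝ := δ / 2 / B with hadef
  have hdiff : Differentiable ℂ fun z : ℂ => (a : ℂ) * z ^ j := by fun_prop
  let p : Entire := ⟨fun z => (a : ℂ) * z ^ j, hdiff⟩
  have hp (z : ℂ) : ‖p z‖ = a * (‖z‖₊ : ℝ) ^ j := by
    change ‖(a : ℂ) * z ^ j‖ = _
    rw [norm_mul, norm_pow, Complex.norm_real, Real.norm_of_nonneg ha.le, coe_nnnorm]
  have hbound (n : ℕ+) (z : ℂ) : ‖p z‖ * hM.weight.expUpper n ‖z‖₊ ≤
      a * M (n * j) ^ (1 / ((n : ℕ) : ℝ)) := by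
    rw [hp, mul_assoc]
    exact mul_le_mul_of_nonneg_left (hM.pow_mul_expUpper_le n j _) ha.le
  have hpm : p ∈ ProjHInf hM.weight.expUpper := by
    refine (Submodule.mem_iInf _).2 fun n => ⟨a * M (n * j) ^ (1 / ((n : ℕ) : ℝ)), ?_⟩
    rintro _ ⟨z, rfl⟩
    exact hbound n z
  have hnorm : ‖ProjHInf.incl hM.weight.expUpper c ⟨p, hpm⟩‖ < δ := by
    refine (HInf.norm_le _ (hbound c)).trans_lt ?_
    rw [← hBdef, hadef, div_mul_cancel₀ _ hB.ne']
    linarith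
  have hN1 := hball _ hnorm
  obtain ⟨t, ht⟩ := hN.exists_le_pow_mul_weight j
  have h1 := (HInf.le_norm (ProjHInf.incl hN.weight.expUpper 1
    (Submodule.inclusion hle ⟨p, hpm⟩)) ((t : ℝ) : ℂ)).trans_lt hN1
  have h2 : a * ((t : ℝ) ^ j * hN.weight t) < 1 := by
    have h3 : ‖p ((t : ℝ) : ℂ)‖ * hN.weight.expUpper 1 ‖((t : ℝ) : ℂ)‖₊ < 1 := h1
    rw [hp, Weight.expUpper_apply] at h3
    simpa [mul_assoc] using h3
  calc N j ≤ (t : ℝ) ^ j * hN.weight t := ht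
    _ ≤ 1 / a := by rw [le_div_iff₀ ha]; linarith
    _ = 2 / δ * B := by rw [hadef]; field_simp
    _ ≤ max (2 / δ) 1 * B := mul_le_mul_of_nonneg_right (le_max_left _ _) hB.le

theorem indHInf_contIncl (hM : IsLC M) (hN : IsLC N) {c : ℕ} (hc : 1 ≤ c) {K : ℝ}
    (h : ∀ t, hN.weight t ^ c ≤ K * hM.weight t) :
    ContIncl (IndHInf hM.weight.expLower) (IndHInf hN.weight.expLower) := by
  lift c to ℕ+ using hc
  refine IndHInf.contIncl fun n => ⟨c * n, K ^ (n : ℕ), fun t => ?_⟩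
  have hv := hN.weight.pos t
  rw [Weight.expLower_apply, Weight.expLower_apply, PNat.mul_coe, pow_mul, ← mul_pow]
  exact pow_le_pow_left₀ (by positivity) (h t) _

theorem projHInf_contIncl (hM : IsLC M) (hN : IsLC N) {c : ℕ} (hc : 1 ≤ c) {K : ℝ} (hK : 0 < K)
    (h : ∀ t, hN.weight t ^ c ≤ K * hM.weight t) :
    ContIncl (ProjHInf hM.weight.expUpper) (ProjHInf hN.weight.expUpper) := by
  lift c to ℕ+ using hc
  refine ProjHInf.contIncl fun n => ⟨c * n, K ^ (1 / (((c * n : ℕ)) : ℝ)), fun t => ?_⟩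
  have hv := hN.weight.pos t
  have hc0 : ((c : ℕ) : ℝ) ≠ 0 := by positivity
  have hn0 : ((n : ℕ) : ℝ) ≠ 0 := by positivity
  have h1 := Real.rpow_le_rpow (by positivity) (h t)
    (show 0 ≤ 1 / (((c * n : ℕ)) : ℝ) by positivity)
  rw [Real.mul_rpow hK.le (hM.weight.pos t).le, ← Real.rpow_natCast, ← Real.rpow_mul hv.le] at h1
  rw [Weight.expUpper_apply, Weight.expUpper_apply, PNat.mul_coe]
  convert h1 using 2
  push_cast
  field_simp

theorem contIncl_tfae (hM : IsLC M) (hN : IsLC N) :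
    List.TFAE
      [ ∃ c : ℕ, 1 ≤ c ∧ ∃ A : ℝ, 1 ≤ A ∧ ∀ j : ℕ, N j ≤ A * M (c * j) ^ (1 / (c : ℝ)),
        hM.weight.PrecPow hN.weight,
        ContIncl (IndHInf hM.weight.expLower) (IndHInf hN.weight.expLower),
        ContIncl (ProjHInf hM.weight.expUpper) (ProjHInf hN.weight.expUpper) ] := by
  rw [Weight.precPow_iff hN.weight_le_one]
  tfae_have 1 → 2 := by
    rintro ⟨c, hc, A, hA, h⟩
    exact ⟨2 * c, by omega, hM.weight_le_of_seq_le hN hc hA h⟩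
  tfae_have 2 → 3 := by
    rintro ⟨c, hc, K, -, h⟩
    exact hM.indHInf_contIncl hN hc h
  tfae_have 3 → 2 := fun h => hM.weight_le_of_indHInf_le hN h.1
  tfae_have 2 → 4 := by
    rintro ⟨c, hc, K, hK, h⟩
    exact hM.projHInf_contIncl hN hc hK h
  tfae_have 4 → 1 := hM.seq_le_of_projHInf hN
  tfae_finish

end IsLC

theorem mainTheorem5 (M N : ℕ → ℝ) (hM : IsLC M) (hN : IsLC N) :
    List.TFAE
      [ ∃ c : ℕ, 1 ≤ c ∧ ∃ A : ℝ, 1 ≤ A ∧ ∀ j : ℕ, N j ≤ A * M (c * j) ^ (1 / (c : ℝ)),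
        hM.weight.PrecPow hN.weight,
        ContIncl (IndHInf hM.weight.expLower) (IndHInf hN.weight.expLower),
        ContIncl (ProjHInf hM.weight.expUpper) (ProjHInf hN.weight.expUpper) ] ∧
    List.TFAE
      [ hM.weight.EquivPow hN.weight,
        EqTVS (IndHInf hM.weight.expLower) (IndHInf hN.weight.expLower),
        EqTVS (ProjHInf hM.weight.expUpper) (ProjHInf hN.weight.expUpper) ] := by
  have h1 := hM.contIncl_tfae hN
  have h2 := hN.contIncl_tfae hM
  refine ⟨h1, ?_⟩
  rw [eqTVS_iff, eqTVS_iff]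
  tfae_have 1 ↔ 2 := and_congr (h1.out 1 2) (h2.out 1 2)
  tfae_have 1 ↔ 3 := and_congr (h1.out 1 3) (h2.out 1 3)
  tfae_finish
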